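/- Let $n,d,m\ge 1$ be integers, let $f_1,\dots,f_n:\mathbb{R}^d\to\mathbb{R}$ be convex and differentiable with $\|\nabla f_i(x)-\nabla f_i(y)\|\le L\|x-y\|$ for all $x,y\in\mathbb{R}^d$ and all $i$, where $L>0$ and $\|\cdot\|$ is the Euclidean norm, and let $R:\mathbb{R}^d\to\mathbb{R}\cup\{+\infty\}$ be proper (not identically $+\infty$), convex and closed. Put $F=\frac1n\sum_{i=1}^n f_i$ and $P=F+R$, and assume that $P$ is strongly convex with parameter $\mu>0$: for all $x,y\in\operatorname{dom}(R)$ and all $\xi\in\partial P(x)$, $$P(y)\ge P(x)+\xi^T(y-x)+\tfrac{\mu}{2}\|y-x\|^2 .$$ Let $x_*=\arg\min_x P(x)$ and let $b\in\{1,\dots,n\}$. The method mS2GD with stepsize $h>0$ and starting point $x_0\in\mathbb{R}^d$ generates $x_1,x_2,\dots$ as follows. Given $x_k$, set $y_{k,0}=x_k$ and draw $t_k$ uniformly at random from $\{1,\dots,m\}$. For $t=0,\dots,t_k-1$ draw a set $A_{kt}$ uniformly at random among the subsets of $\{1,\dots,n\}$ of size $b$, and set $$G_{k,t}=\nabla F(x_k)+\frac1b\sum_{i\in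 A_{kt}}\bigl(\nabla f_i(y_{k,t})-\nabla f_i(x_k)\bigr),\qquad y_{k,t+1}=\operatorname{prox}_{hR}\bigl(y_{k,t}-hG_{k,t}\bigr),$$ where $\operatorname{prox}_{hR}(z)=\arg\min_{x}\{\frac12\|x-z\|^2+hR(x)\}$. Finally set $x_{k+1}=y_{k,t_k}$. All random draws are independent. Let $\alpha(b)=\frac{n-b}{b(n-1)}$ (with $\alpha(1)=0$ if $n=1$). Assume that $0<h\le 1/L$, that $4hL\alpha(b)<1$, and that $$\rho=\frac{1}{mh\mu(1-4hL\alpha(b))}+\frac{4hL\alpha(b)(m+1)}{m(1-4hL\alpha(b))}<1 .$$ Then for every $k\ge 0$ $$\mathbb{E}[P(x_k)-P(x_*)]\le\rho^k\,[P(x_0)-P(x_*)].$$ -/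

import Mathlib

open scoped ENNReal

namespace MS2GD

/-- The space `ℝ^d` with the Euclidean norm. -/
abbrev Vec (d : ℕ) : Type := EuclideanSpace ℝ (Fin d)

/-- Effective domain of an extended-real-valued function. -/
def dom {d : ℕ} (g : Vec d → EReal) : Set (Vec d) := {x | g x < ⊤}

/-- Epigraph of an extended-real-valued function, as a subset of `ℝ^d × ℝ`. -/
def epigraph {d : ℕ} (g : Vec d → EReal) : Set (Vec d × ℝ) := {p | g p.1 ≤ (p.2 : EReal)}

/-- `g` takes values in `ℝ ∪ {+∞}` and is not identically `+∞`. -/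
def IsProper {d : ℕ} (g : Vec d → EReal) : Prop := (∀ x, g x ≠ ⊥) ∧ (dom g).Nonempty

/-- Convexity of an extended-real-valued function: the epigraph is convex. -/
def IsConvexFun {d : ℕ} (g : Vec d → EReal) : Prop := Convex ℝ (epigraph g)

/-- Closedness of an extended-real-valued function: the epigraph is closed. -/
def IsClosedFun {d : ℕ} (g : Vec d → EReal) : Prop := IsClosed (epigraph g)

/-- `x` is a global minimizer of `g`. -/
def IsMinimizer {d : ℕ} (g : Vec d → EReal) (x : Vec d) : Prop := ∀ y, g x ≤ g y

/-- A global minimizer of `g` (an arbitrary point if `g` has none). -/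
noncomputable def argmin {d : ℕ} (g : Vec d → EReal) : Vec d :=
  Classical.epsilon (IsMinimizer g)

/-- The subdifferential of `g` at `x`. -/
def subdifferential {d : ℕ} (g : Vec d → EReal) (x : Vec d) : Set (Vec d) :=
  {ξ | x ∈ dom g ∧ ∀ y, g x + ((inner ℝ ξ (y - x) : ℝ) : EReal) ≤ g y}

/-- Strong convexity with parameter `μ`, in subgradient form. -/
def IsStronglyConvex {d : ℕ} (μ : ℝ) (g : Vec d → EReal) : Prop :=
  ∀ x ∈ dom g, ∀ y ∈ dom g, ∀ ξ ∈ subdifferential g x,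
    g x + ((inner ℝ ξ (y - x) + μ / 2 * ‖y - x‖ ^ 2 : ℝ) : EReal) ≤ g y

/-- The smooth part `F = (1/n) ∑ f_i`. -/
noncomputable def avg {d n : ℕ} (f : Fin n → Vec d → ℝ) (x : Vec d) : ℝ :=
  (1 / (n : ℝ)) * ∑ i, f i x

/-- The composite objective `P = F + R`. -/
noncomputable def objective {d n : ℕ} (f : Fin n → Vec d → ℝ) (R : Vec d → EReal)
    (x : Vec d) : EReal :=
  (avg f x : EReal) + R x

/-- The proximal operator `prox_{hR}(z) = argmin_x { ‖x - z‖² / 2 + h R(x) }`. -/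
noncomputable def prox {d : ℕ} (h : ℝ) (R : Vec d → EReal) (z : Vec d) : Vec d :=
  argmin fun x => ((1 / 2 * ‖x - z‖ ^ 2 : ℝ) : EReal) + (h : EReal) * R x

/-- The semi-stochastic gradient estimate at `y`, with reference point `x` and mini-batch `A` of
size `b`: `∇F(x) + (1/b) ∑_{i ∈ A} (∇f_i(y) - ∇f_i(x))`. -/
noncomputable def gradEstimate {d n : ℕ} (f : Fin n → Vec d → ℝ) (b : ℕ) (x y : Vec d)
    (A : Finset (Fin n)) : Vec d :=
  gradient (avg f) x + (1 / (b : ℝ)) • ∑ i ∈ A, (gradient (f i) y - gradient (f i) x)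

/-- The uniform distribution on the subsets of `{1, …, n}` of size `b`. -/
noncomputable def miniBatch {n b : ℕ} (hb : b ≤ n) : PMF (Finset (Fin n)) :=
  PMF.uniformOfFinset (Finset.powersetCard b Finset.univ)
    (Finset.powersetCard_nonempty.2 (by simpa using hb))

/-- The uniform distribution on `{1, …, m}`. -/
noncomputable def epochLength {m : ℕ} (hm : 1 ≤ m) : PMF ℕ :=
  PMF.uniformOfFinset (Finset.Icc 1 m) (Finset.nonempty_Icc.2 hm)

/-- The law of the inner iterate `y_{k,t}` of an epoch that starts at `x_k = x`. In each step a
fresh mini-batch is drawn, independently of the past. -/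
noncomputable def innerIterate {d n b : ℕ} (hb : b ≤ n) (f : Fin n → Vec d → ℝ)
    (R : Vec d → EReal) (h : ℝ) (x : Vec d) : ℕ → PMF (Vec d)
  | 0 => PMF.pure x
  | t + 1 => (innerIterate hb f R h x t).bind fun y =>
      (miniBatch hb).map fun A => prox h R (y - h • gradEstimate f b x y A)

/-- The law of `x_{k+1} = y_{k,t_k}` given `x_k = x`: the number `t_k` of inner steps is uniform
on `{1, …, m}`. -/
noncomputable def epoch {d n b m : ℕ} (hb : b ≤ n) (hm : 1 ≤ m) (f : Fin n → Vec d → ℝ)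
    (R : Vec d → EReal) (h : ℝ) (x : Vec d) : PMF (Vec d) :=
  (epochLength hm).bind fun t => innerIterate hb f R h x t

/-- The law of the outer iterate `x_k` of mS2GD with starting point `x₀`. -/
noncomputable def iterate {d n b m : ℕ} (hb : b ≤ n) (hm : 1 ≤ m) (f : Fin n → Vec d → ℝ)
    (R : Vec d → EReal) (h : ℝ) (x₀ : Vec d) : ℕ → PMF (Vec d)
  | 0 => PMF.pure x₀
  | k + 1 => (iterate hb hm f R h x₀ k).bind (epoch hb hm f R h)

/-- Expectation of a nonnegative, possibly infinite, function under a discrete law. -/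
noncomputable def expect {α : Type*} (p : PMF α) (g : α → ℝ≥0∞) : ℝ≥0∞ := ∑' a, p a * g a

/-- The suboptimality gap `g x - g x_*` as an element of `[0, ∞]`; it is used for a minimizer
`x_*` of `g` with a finite value, where the difference is nonnegative, so nothing is cut off. -/
noncomputable def gap {d : ℕ} (g : Vec d → EReal) (xs x : Vec d) : ℝ≥0∞ :=
  (g x - g xs).toENNReal

/-- `α(b) = (n - b) / (b (n - 1))`. For `n = b = 1` this is `0`, in agreement with `α(n) = 0`. -/
noncomputable def alpha (n b : ℕ) : ℝ := ((n : ℝ) - b) / ((b : ℝ) * ((n : ℝ) - 1))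

/-- The convergence factor `ρ`. -/
noncomputable def rate (n b m : ℕ) (h L μ : ℝ) : ℝ :=
  1 / ((m : ℝ) * h * μ * (1 - 4 * h * L * alpha n b)) +
    4 * h * L * alpha n b * ((m : ℝ) + 1) / ((m : ℝ) * (1 - 4 * h * L * alpha n b))

end MS2GD

/-!
Fix the reference point `x` of an epoch, a current inner iterate `y`, and the minimizer `x_*`.

A proximal step along an estimate `v` of `∇F y` produces `p` with
`‖p - x_*‖² + 2h (P p - P x_*) ≤ ‖y - x_*‖² + 2h² ‖v - ∇F y‖² + 2h ⟪v - ∇F y, x_* - p'⟫`,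
where `p'` is the proximal point of the exact gradient step (`MS2GD.norm_sub_sq_add_le_of_prox`).
This combines convexity of `F`, the descent lemma with `h L ≤ 1`, the variational inequality of the
proximal operator and its nonexpansiveness. Since `p'` does not depend on the mini-batch and the
estimator is unbiased, averaging over the mini-batches removes the inner product.

The error `v - ∇F y` is the deviation of a mini-batch mean from the full mean of the vectors
`∇f_i y - ∇f_i x`. Sampling without replacement gives variance at most `α(b)` times their mean
square (`sum_powersetCard_norm_avg_sub_sq_le`), which by cocoercivity of the gradients, with `∇f_i x_*`
inserted, is at most `4 L (D y + D x)`, where `D` is the Bregman distance of `F` to `x_*`. First-order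
optimality of `x_*` for `P = F + R` bounds `D` by the gap of `P` (`MS2GD.ofReal_bregman_le_gap`).
Hence `V (t + 1) + 2h G (t + 1) ≤ V t + 8h² L α(b) (G t + G 0)` for the expected squared distance `V t`
and the expected gap `G t` of the inner iterates. Summing over `t < m` and using
`V 0 ≤ (2 / μ) G 0`, which is strong convexity at `x_*`, bounds the average of `G 1, …, G m` by
`ρ G 0` (`MS2GD.expect_epoch_gap_le`). The average is the expected gap after the epoch, because its
length is uniform on `{1, …, m}`; the theorem follows by induction on the number of epochs.

Proximal points exist because the first-order condition at `x_*` supplies an affine minorant of `R`,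
which makes the proximal objective coercive. Expectations take values in `[0, ∞]`, so a starting
point outside the domain of `R`, whose gap is infinite, needs no separate hypothesis.
-/

/-! ### Convex functions with Lipschitz gradient -/

section Smooth

variable {E : Type*} [NormedAddCommGroup E] [InnerProductSpace ℝ E] [CompleteSpace E]

theorem HasGradientAt.hasDerivAt_comp_line {f : E → ℝ} {g x v : E} {t : ℝ}
    (hf : HasGradientAt f g (x + t • v)) :
    HasDerivAt (fun s : ℝ => f (x + s • v)) (inner ℝ g v) t := by
  have h1 : HasDerivAt (fun s : ℝ => x + s • v) v t := by
    simpa using ((hasDerivAt_id t).smul_const v).const_add x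
  have h2 := hf.hasFDerivAt.comp_hasDerivAt t h1
  simpa [Function.comp_def] using h2

theorem ConvexOn.add_inner_gradient_le {f : E → ℝ} (hc : ConvexOn ℝ Set.univ f)
    (hd : Differentiable ℝ f) (x y : E) :
    f x + inner ℝ (gradient f x) (y - x) ≤ f y := by
  have hg : ConvexOn ℝ Set.univ (fun s : ℝ => f (x + s • (y - x))) := by
    have := hc.comp_affineMap (AffineMap.lineMap x y : ℝ →ᵃ[ℝ] E)
    simpa [Function.comp_def, AffineMap.lineMap_apply, add_comm] using this
  have hder : HasDerivAt (fun s : ℝ => f (x + s • (y - x)))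
      (inner ℝ (gradient f x) (y - x)) 0 :=
    HasGradientAt.hasDerivAt_comp_line (by simpa using (hd x).hasGradientAt)
  have := hg.le_slope_of_hasDerivAt (Set.mem_univ 0) (Set.mem_univ 1) one_pos hder
  simp only [slope_def_field, one_smul, zero_smul, add_zero, add_sub_cancel, sub_zero,
    div_one] at this
  linarith

/-- The descent lemma: a function with `L`-Lipschitz gradient lies below its quadratic model. -/
theorem le_add_inner_gradient_add_sq {f : E → ℝ} {L : ℝ} (hd : Differentiable ℝ f)
    (hl : ∀ x y, ‖gradient f x - gradient f y‖ ≤ L * ‖x - y‖) (x y : E) :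
    f y ≤ f x + inner ℝ (gradient f x) (y - x) + L / 2 * ‖y - x‖ ^ 2 := by
  set v := y - x with hv
  let φ : ℝ → ℝ := fun s => f (x + s • v) - s * inner ℝ (gradient f x) v - L / 2 * s ^ 2 * ‖v‖ ^ 2
  have hφ : ∀ t, HasDerivAt φ (inner ℝ (gradient f (x + t • v)) v - inner ℝ (gradient f x) v
      - L * t * ‖v‖ ^ 2) t := by
    intro t
    have h1 := ((hd (x + t • v)).hasGradientAt).hasDerivAt_comp_line
    have h2 := (hasDerivAt_id t).mul_const (inner ℝ (gradient f x) v)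
    have h3 := (((hasDerivAt_id t).pow 2).const_mul (L / 2)).mul_const (‖v‖ ^ 2)
    refine ((h1.sub h2).sub h3).congr_deriv ?_
    simp only [one_mul, id, Nat.cast_ofNat, mul_one, Nat.add_one_sub_one, pow_one]; ring
  have hanti : AntitoneOn φ (Set.Icc 0 1) := by
    refine antitoneOn_of_deriv_nonpos (convex_Icc 0 1)
      (fun t _ => (hφ t).continuousAt.continuousWithinAt)
      (fun t _ => (hφ t).differentiableAt.differentiableWithinAt) fun t ht => ?_
    rw [interior_Icc] at ht
    rw [(hφ t).deriv, ← inner_sub_left]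
    have h1 := real_inner_le_norm (gradient f (x + t • v) - gradient f x) v
    have h2 := hl (x + t • v) x
    rw [add_sub_cancel_left, norm_smul, Real.norm_of_nonneg ht.1.le] at h2
    nlinarith [norm_nonneg v, mul_le_mul_of_nonneg_right h2 (norm_nonneg v)]
  have := hanti (Set.left_mem_Icc.2 zero_le_one) (Set.right_mem_Icc.2 zero_le_one) zero_le_one
  simp only [φ, one_smul, zero_smul, add_zero, one_mul, zero_mul, one_pow, mul_one, sub_zero,
    ne_eq, OfNat.ofNat_ne_zero, not_false_eq_true, zero_pow, mul_zero] at this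
  rw [hv, add_sub_cancel, ← hv] at this
  linarith

/-- Cocoercivity of the gradient: minimize the quadratic model of
`u ↦ f u - ⟪∇ f y, u⟫` at `x`, whose global minimizer is `y`. -/
theorem ConvexOn.norm_sub_gradient_sq_le {f : E → ℝ} {L : ℝ} (hL : 0 < L)
    (hc : ConvexOn ℝ Set.univ f) (hd : Differentiable ℝ f)
    (hl : ∀ x y, ‖gradient f x - gradient f y‖ ≤ L * ‖x - y‖) (x y : E) :
    ‖gradient f x - gradient f y‖ ^ 2 ≤
      2 * L * (f x - f y - inner ℝ (gradient f y) (x - y)) := by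
  set w := gradient f x - gradient f y with hw
  have h1 := le_add_inner_gradient_add_sq hd hl x (x - L⁻¹ • w)
  have h2 := hc.add_inner_gradient_le hd y (x - L⁻¹ • w)
  have e1 : x - L⁻¹ • w - x = -(L⁻¹ • w) := by abel
  have e2 : x - L⁻¹ • w - y = (x - y) - L⁻¹ • w := by abel
  rw [e1, inner_neg_right, inner_smul_right, norm_neg, norm_smul, mul_pow,
    Real.norm_of_nonneg (inv_nonneg.2 hL.le)] at h1
  rw [e2, inner_sub_right, inner_smul_right] at h2
  have h3 : inner ℝ (gradient f x) w - inner ℝ (gradient f y) w = ‖w‖ ^ 2 := by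
    rw [← inner_sub_left, ← hw, real_inner_self_eq_norm_sq]
  have h4 : L⁻¹ * ‖w‖ ^ 2 / 2 ≤ f x - f y - inner ℝ (gradient f y) (x - y) := by
    have e3 : L / 2 * ((L⁻¹) ^ 2 * ‖w‖ ^ 2) = L⁻¹ * ‖w‖ ^ 2 / 2 := by field_simp
    rw [e3] at h1
    have e4 : L⁻¹ * inner ℝ (gradient f x) w - L⁻¹ * inner ℝ (gradient f y) w
      = L⁻¹ * ‖w‖ ^ 2 := by rw [← mul_sub, h3]
    linarith
  calc ‖w‖ ^ 2 = 2 * L * (L⁻¹ * ‖w‖ ^ 2 / 2) := by field_simp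
    _ ≤ _ := by gcongr

end Smooth

/-! ### Sampling without replacement -/

section Sampling

open Finset

theorem card_filter_disjoint_powersetCard {n : ℕ} (b : ℕ) (s : Finset (Fin n)) :
    #((powersetCard b (univ : Finset (Fin n))).filter (fun A => Disjoint s A)) =
      (n - #s).choose b := by
  have : (powersetCard b (univ : Finset (Fin n))).filter (fun A => Disjoint s A) =
      powersetCard b sᶜ := by
    ext A
    simp only [mem_filter, mem_powersetCard, subset_univ, true_and, subset_compl_iff_disjoint_left]
    tauto
  rw [this, card_powersetCard, card_compl, Fintype.card_fin]

variable {E : Type*} [NormedAddCommGroup E] [InnerProductSpace ℝ E]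

/-- For a centred family, the sum over `A` is minus the sum over the complement of `A`. -/
theorem sum_eq_neg_sum_ite {E : Type*} [AddCommGroup E] {n : ℕ} {η : Fin n → E}
    (hη : ∑ i, η i = 0) (A : Finset (Fin n)) :
    ∑ i ∈ A, η i = -∑ i, if i ∈ A then 0 else η i := by
  rw [eq_neg_iff_add_eq_zero]
  refine Eq.trans ?_ hη
  rw [← sum_filter_add_sum_filter_not univ (· ∈ A) η]
  congr 1
  · simp
  · rw [sum_filter]; exact sum_congr rfl fun i _ => by by_cases h : i ∈ A <;> simp [h]

theorem sum_powersetCard_sum_eq_zero {E : Type*} [AddCommGroup E] {n : ℕ} (b : ℕ)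
    {η : Fin n → E} (hη : ∑ i, η i = 0) :
    ∑ A ∈ powersetCard b (univ : Finset (Fin n)), ∑ i ∈ A, η i = 0 := by
  simp_rw [sum_eq_neg_sum_ite hη]
  rw [sum_neg_distrib, sum_comm]
  have : ∀ i : Fin n, ∑ A ∈ powersetCard b (univ : Finset (Fin n)), (if i ∈ A then 0 else η i) =
      (n - 1).choose b • η i := by
    intro i
    have h := card_filter_disjoint_powersetCard b {i}
    simp only [disjoint_singleton_left, card_singleton] at h
    rw [← h, ← sum_const, sum_filter]
    exact sum_congr rfl fun A _ => by split_ifs <;> simp_all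
  simp_rw [this]
  rw [← smul_sum, hη, smul_zero, neg_zero]

/-- The second moment of a sum over a uniformly random `b`-subset of a centred family. Passing to
complements, the pair `(i, j)` is counted once for each `b`-subset that avoids both indices. -/
theorem sum_powersetCard_norm_sum_sq {n b : ℕ} (hn : 2 ≤ n) (hb : 1 ≤ b) {η : Fin n → E}
    (hη : ∑ i, η i = 0) :
    ∑ A ∈ powersetCard b (univ : Finset (Fin n)), ‖∑ i ∈ A, η i‖ ^ 2 =
      (n - 2).choose (b - 1) * ∑ i, ‖η i‖ ^ 2 := by
  have h1 : ∀ A : Finset (Fin n), ‖∑ i ∈ A, η i‖ ^ 2 =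
      ∑ i, ∑ j, if Disjoint {i, j} A then inner ℝ (η i) (η j) else 0 := by
    intro A
    rw [sum_eq_neg_sum_ite hη, norm_neg, ← real_inner_self_eq_norm_sq, sum_inner]
    refine sum_congr rfl fun i _ => ?_
    rw [inner_sum]
    refine sum_congr rfl fun j _ => ?_
    by_cases hi : i ∈ A <;> by_cases hj : j ∈ A <;> simp [hi, hj]
  have h2 : ∀ i j : Fin n, (∑ A ∈ powersetCard b (univ : Finset (Fin n)),
      if Disjoint {i, j} A then inner ℝ (η i) (η j) else (0 : ℝ)) =
      (n - 2).choose b * inner ℝ (η i) (η j) +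
        if i = j then (n - 2).choose (b - 1) * ‖η i‖ ^ 2 else 0 := by
    intro i j
    rw [← sum_filter, sum_const, card_filter_disjoint_powersetCard, nsmul_eq_mul]
    split_ifs with hij
    · subst hij
      obtain ⟨n, rfl⟩ := Nat.exists_eq_add_of_le' hn
      obtain ⟨b, rfl⟩ := Nat.exists_eq_add_of_le' hb
      simp [Nat.choose_succ_succ]; ring
    · rw [card_pair hij, add_zero]
  simp_rw [h1]
  rw [sum_comm]
  simp_rw [sum_comm (s := powersetCard b univ), h2, sum_add_distrib, ← mul_sum, ← inner_sum]
  rw [← sum_inner]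
  simp [hη, mul_sum]

theorem MS2GD.alpha_nonneg {n b : ℕ} (hb : 1 ≤ b) (hbn : b ≤ n) : 0 ≤ alpha n b := by
  have h1 : (b : ℝ) ≤ n := by exact_mod_cast hbn
  have h2 : (1 : ℝ) ≤ b := by exact_mod_cast hb
  exact div_nonneg (by linarith) (mul_nonneg (by linarith) (by linarith))

theorem sub_two_choose_eq_alpha {n b : ℕ} (hn : 2 ≤ n) (hb : 1 ≤ b) (hbn : b ≤ n) :
    ((n - 2).choose (b - 1) : ℝ) = MS2GD.alpha n b * b ^ 2 * n.choose b / n := by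
  obtain ⟨n, rfl⟩ := Nat.exists_eq_add_of_le' hn
  obtain ⟨b, rfl⟩ := Nat.exists_eq_add_of_le' hb
  have h1 := Nat.add_one_mul_choose_eq (n + 1) b
  have h2 := Nat.choose_mul_succ_eq n b
  have h1' : ((n : ℝ) + 2) * (n + 1).choose b = (n + 2).choose (b + 1) * (b + 1) := by
    have : ((n + 1 + 1 : ℕ) : ℝ) * ((n + 1).choose b : ℕ) =
      ((n + 1 + 1).choose (b + 1) : ℕ) * ((b + 1 : ℕ) : ℝ) := by exact_mod_cast h1
    push_cast at this; linarith
  have h2' : (n.choose b : ℝ) * (n + 1) = (n + 1).choose b * (n + 1 - b) := by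
    have : ((n.choose b : ℕ) : ℝ) * ((n + 1 : ℕ) : ℝ) =
      ((n + 1).choose b : ℕ) * ((n + 1 - b : ℕ) : ℝ) := by exact_mod_cast h2
    rw [Nat.cast_sub (by omega)] at this
    push_cast at this; linarith
  simp only [MS2GD.alpha, Nat.add_sub_cancel]
  push_cast
  have e1 : ((n : ℝ) + 2 - 1) ≠ 0 := by have := Nat.cast_nonneg (α := ℝ) n; linarith
  have e2 : ((n : ℝ) + 2) ≠ 0 := by positivity
  have e3 : ((b : ℝ) + 1) ≠ 0 := by positivity
  rw [div_mul_eq_mul_div, div_mul_eq_mul_div, div_div, eq_div_iff (by positivity)]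
  linear_combination (((n : ℝ) + 2) * (b + 1)) * h2' + ((n : ℝ) + 1 - b) * (b + 1) * h1'

theorem avg_sub_avg_eq {n b : ℕ} (hb : 1 ≤ b) (ξ : Fin n → E) {A : Finset (Fin n)}
    (hA : A ∈ powersetCard b (univ : Finset (Fin n))) :
    (1 / (b : ℝ)) • ∑ i ∈ A, ξ i - (1 / (n : ℝ)) • ∑ i, ξ i =
      (1 / (b : ℝ)) • ∑ i ∈ A, (ξ i - (1 / (n : ℝ)) • ∑ j, ξ j) := by
  have hb' : (b : ℝ) ≠ 0 := by positivity
  rw [sum_sub_distrib, sum_const, (mem_powersetCard.1 hA).2, smul_sub, ← Nat.cast_smul_eq_nsmul ℝ,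
    smul_smul, one_div_mul_cancel hb', one_smul]

theorem sum_sub_avg_eq_zero {n : ℕ} (ξ : Fin n → E) :
    ∑ i, (ξ i - (1 / (n : ℝ)) • ∑ j, ξ j) = 0 := by
  rcases Nat.eq_zero_or_pos n with rfl | hn
  · simp
  · have hn' : (n : ℝ) ≠ 0 := by positivity
    rw [sum_sub_distrib, sum_const, card_univ, Fintype.card_fin, ← Nat.cast_smul_eq_nsmul ℝ,
      smul_smul, mul_one_div_cancel hn', one_smul, sub_self]

theorem sum_powersetCard_avg_sub_avg {n b : ℕ} (hb : 1 ≤ b) (ξ : Fin n → E) :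
    ∑ A ∈ powersetCard b (univ : Finset (Fin n)),
        ((1 / (b : ℝ)) • ∑ i ∈ A, ξ i - (1 / (n : ℝ)) • ∑ i, ξ i) = 0 := by
  rw [sum_congr rfl fun A hA => avg_sub_avg_eq hb ξ hA, ← smul_sum,
    sum_powersetCard_sum_eq_zero b (sum_sub_avg_eq_zero ξ), smul_zero]

theorem sum_norm_sub_avg_sq_le {n : ℕ} (ξ : Fin n → E) :
    ∑ i, ‖ξ i - (1 / (n : ℝ)) • ∑ j, ξ j‖ ^ 2 ≤ ∑ i, ‖ξ i‖ ^ 2 := by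
  set a := (1 / (n : ℝ)) • ∑ j, ξ j with ha
  have h0 : ∑ i, inner ℝ (ξ i - a) a = 0 := by
    rw [← sum_inner, sum_sub_avg_eq_zero, inner_zero_left]
  have h1 : ∀ i, ‖ξ i‖ ^ 2 = ‖ξ i - a‖ ^ 2 + 2 * inner ℝ (ξ i - a) a + ‖a‖ ^ 2 := fun i => by
    rw [← norm_add_sq_real, sub_add_cancel]
  simp_rw [h1]
  rw [sum_add_distrib, sum_add_distrib, ← mul_sum, h0]
  have : 0 ≤ ∑ _i : Fin n, ‖a‖ ^ 2 := by positivity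
  linarith

/-- The variance of a mini-batch average: sampling `b` out of `n` vectors without replacement
multiplies their mean square by at most `α(b)`. -/
theorem sum_powersetCard_norm_avg_sub_sq_le {n b : ℕ} (hb : 1 ≤ b) (hbn : b ≤ n) (ξ : Fin n → E) :
    ∑ A ∈ powersetCard b (univ : Finset (Fin n)),
        ‖(1 / (b : ℝ)) • ∑ i ∈ A, ξ i - (1 / (n : ℝ)) • ∑ i, ξ i‖ ^ 2 ≤
      n.choose b * (MS2GD.alpha n b * ((1 / (n : ℝ)) * ∑ i, ‖ξ i‖ ^ 2)) := by
  have hα := MS2GD.alpha_nonneg hb hbn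
  rcases (hb.trans hbn).eq_or_lt with rfl | hn
  -- For `n = 1` the definition of `α` divides by zero, but the variance itself vanishes.
  · obtain rfl : b = 1 := le_antisymm hbn hb
    have : powersetCard 1 (univ : Finset (Fin 1)) = {univ} := powersetCard_self _
    rw [this, sum_singleton]
    simp [MS2GD.alpha]
  · have h1 : ∀ A ∈ powersetCard b (univ : Finset (Fin n)),
        ‖(1 / (b : ℝ)) • ∑ i ∈ A, ξ i - (1 / (n : ℝ)) • ∑ i, ξ i‖ ^ 2 =
        (1 / (b : ℝ)) ^ 2 * ‖∑ i ∈ A, (ξ i - (1 / (n : ℝ)) • ∑ j, ξ j)‖ ^ 2 := fun A hA => by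
      rw [avg_sub_avg_eq hb ξ hA, norm_smul, mul_pow, Real.norm_of_nonneg (by positivity)]
    rw [sum_congr rfl h1, ← mul_sum, sum_powersetCard_norm_sum_sq hn hb (sum_sub_avg_eq_zero ξ),
      sub_two_choose_eq_alpha hn hb hbn]
    have hb' : (b : ℝ) ≠ 0 := by positivity
    calc _ = n.choose b * (MS2GD.alpha n b *
          ((1 / (n : ℝ)) * ∑ i, ‖ξ i - (1 / (n : ℝ)) • ∑ j, ξ j‖ ^ 2)) := by field_simp
      _ ≤ _ := by gcongr ?_ * (?_ * (?_ * ?_)); exact sum_norm_sub_avg_sq_le ξ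

end Sampling

/-! ### Minimizers of composite functions and the proximal operator -/

namespace MS2GD

variable {d : ℕ} {R : Vec d → EReal}

theorem IsProper.coe_toReal (hR : IsProper R) {x : Vec d} (hx : x ∈ dom R) :
    ((R x).toReal : EReal) = R x :=
  EReal.coe_toReal (ne_of_lt hx) (hR.1 x)

theorem IsMinimizer.mem_dom {q : Vec d → ℝ} {c : ℝ} (hc : 0 < c) (hR : IsProper R) {p : Vec d}
    (hp : IsMinimizer (fun x => (q x : EReal) + (c : EReal) * R x) p) : p ∈ dom R := by
  obtain ⟨u, hu⟩ := hR.2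
  by_contra h
  have h1 : R p = ⊤ := not_lt_top_iff.1 h
  have h2 := hp u
  simp only [h1, EReal.coe_mul_top_of_pos hc] at h2
  rw [← hR.coe_toReal hu, EReal.coe_add_top, top_le_iff] at h2
  exact EReal.coe_ne_top (q u + c * (R u).toReal) (by push_cast; exact h2)

theorem IsMinimizer.toReal_le {q : Vec d → ℝ} {c : ℝ} (hc : 0 < c) (hR : IsProper R) {p u : Vec d}
    (hp : IsMinimizer (fun x => (q x : EReal) + (c : EReal) * R x) p) (hu : u ∈ dom R) :
    q p + c * (R p).toReal ≤ q u + c * (R u).toReal := by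
  have h := hp u
  simp only at h
  rw [← hR.coe_toReal hu, ← hR.coe_toReal (hp.mem_dom hc hR)] at h
  exact_mod_cast h

theorem IsConvexFun.le_line (hR : IsProper R) (hconv : IsConvexFun R) {x y : Vec d}
    (hx : x ∈ dom R) (hy : y ∈ dom R) {t : ℝ} (ht : t ∈ Set.Icc (0 : ℝ) 1) :
    x + t • (y - x) ∈ dom R ∧
      (R (x + t • (y - x))).toReal ≤ (R x).toReal + t * ((R y).toReal - (R x).toReal) := by
  have h1 : (x, (R x).toReal) ∈ epigraph R := (hR.coe_toReal hx).ge
  have h2 : (y, (R y).toReal) ∈ epigraph R := (hR.coe_toReal hy).ge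
  have h3 := hconv.add_smul_sub_mem h1 h2 ht
  have h4 : R (x + t • (y - x)) ≤
      (((R x).toReal + t * ((R y).toReal - (R x).toReal) : ℝ) : EReal) := h3
  have h5 : x + t • (y - x) ∈ dom R := h4.trans_lt (EReal.coe_lt_top _)
  rw [← hR.coe_toReal h5] at h4
  exact ⟨h5, EReal.coe_le_coe_iff.1 h4⟩

/-- First-order optimality: at a minimizer `p` of `q + c R`, with `q` differentiable and `R`
convex, `-∇q(p)` is a subgradient of `c R`. -/
theorem IsMinimizer.sub_inner_le {q : Vec d → ℝ} {c : ℝ} (hc : 0 < c) (hR : IsProper R)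
    (hconv : IsConvexFun R) {p u g : Vec d}
    (hp : IsMinimizer (fun x => (q x : EReal) + (c : EReal) * R x) p) (hq : HasGradientAt q g p)
    (hu : u ∈ dom R) :
    c * (R p).toReal - inner ℝ g (u - p) ≤ c * (R u).toReal := by
  have hpd := hp.mem_dom hc hR
  let φ : ℝ → ℝ := fun t => q (p + t • (u - p)) + t * (c * ((R u).toReal - (R p).toReal))
  have hφ : HasDerivAt φ (inner ℝ g (u - p) + c * ((R u).toReal - (R p).toReal)) 0 := by
    have h1 := HasGradientAt.hasDerivAt_comp_line (x := p) (v := u - p) (t := 0) (f := q) (g := g)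
      (by simpa using hq)
    have h2 := (hasDerivAt_id (0 : ℝ)).mul_const (c * ((R u).toReal - (R p).toReal))
    exact (h1.add h2).congr_deriv (by simp)
  have hmin : IsLocalMinOn φ (Set.Icc 0 1) 0 := by
    refine Filter.eventually_of_mem self_mem_nhdsWithin fun t ht => ?_
    obtain ⟨h1, h2⟩ := hconv.le_line hR hpd hu ht
    have h3 := hp.toReal_le hc hR h1
    have h4 := mul_le_mul_of_nonneg_left h2 hc.le
    simp only [φ, zero_smul, add_zero, zero_mul]
    linarith
  have h := hmin.hasFDerivWithinAt_nonneg hφ.hasFDerivAt.hasFDerivWithinAt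
    (y := (1 : ℝ)) (mem_posTangentConeAt_of_segment_subset (by
      rw [zero_add, segment_eq_Icc zero_le_one]))
  simp at h
  linarith

theorem lowerSemicontinuous_add_mul (hR : IsProper R) (hcl : IsClosedFun R) {q : Vec d → ℝ}
    (hq : Continuous q) {c : ℝ} (hc : 0 < c) :
    LowerSemicontinuous fun x => (q x : EReal) + (c : EReal) * R x := by
  have key : ∀ (x : Vec d) (t : ℝ), (q x : EReal) + (c : EReal) * R x ≤ t ↔
      R x ≤ (((t - q x) / c : ℝ) : EReal) := by
    intro x t
    by_cases hx : x ∈ dom R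
    · rw [← hR.coe_toReal hx, EReal.coe_le_coe_iff, le_div_iff₀ hc, ← EReal.coe_mul,
        ← EReal.coe_add, EReal.coe_le_coe_iff, le_sub_iff_add_le, add_comm, mul_comm c]
    · have h1 : R x = ⊤ := not_lt_top_iff.1 hx
      simp [h1, EReal.coe_mul_top_of_pos hc]
  rw [lowerSemicontinuous_iff_isClosed_preimage]
  intro t
  induction t with
  | bot =>
    convert isClosed_empty
    ext x
    simp only [Set.mem_preimage, Set.mem_Iic, le_bot_iff, Set.mem_empty_iff_false, iff_false]
    by_cases hx : x ∈ dom R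
    · rw [← hR.coe_toReal hx, ← EReal.coe_mul, ← EReal.coe_add]
      exact EReal.coe_ne_bot _
    · have h1 : R x = ⊤ := not_lt_top_iff.1 hx
      simp [h1, EReal.coe_mul_top_of_pos hc]
  | top => simp
  | coe t =>
    have h : Continuous fun x : Vec d => (x, (t - q x) / c) := by fun_prop
    convert hcl.preimage h using 1
    ext x
    exact key x t

/-- Existence of proximal points: an affine minorant of `R` makes the prox objective coercive. -/
theorem isMinimizer_prox (hR : IsProper R) (hcl : IsClosedFun R) {c : ℝ} (hc : 0 < c)
    {a : Vec d} {β : ℝ} (ha : ∀ x ∈ dom R, inner ℝ a x + β ≤ (R x).toReal) (z : Vec d) :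
    IsMinimizer (fun x => ((1 / 2 * ‖x - z‖ ^ 2 : ℝ) : EReal) + (c : EReal) * R x)
      (prox c R z) := by
  refine Classical.epsilon_spec (p := IsMinimizer _) ?_
  obtain ⟨u, hu⟩ := hR.2
  set N := 1 / 2 * ‖u - z‖ ^ 2 + c * (R u).toReal - c * β - c * inner ℝ a z with hN
  set r := 2 * c * ‖a‖ + 2 * |N| + 1 with hr
  have hball : ∀ x ∈ dom R, 1 / 2 * ‖x - z‖ ^ 2 + c * (R x).toReal ≤
      1 / 2 * ‖u - z‖ ^ 2 + c * (R u).toReal → x ∈ Metric.closedBall z r := by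
    intro x hx hle
    rw [mem_closedBall_iff_norm]
    by_contra! hlt
    have h1 := mul_le_mul_of_nonneg_left (ha x hx) hc.le
    have h2 : inner ℝ a x = inner ℝ a (x - z) + inner ℝ a z := by
      rw [← inner_add_right, sub_add_cancel]
    have h3 := neg_le_of_abs_le (abs_real_inner_le_norm a (x - z))
    have h3' := mul_le_mul_of_nonneg_left h3 hc.le
    have h4 : 1 / 2 * ‖x - z‖ ^ 2 - c * (‖a‖ * ‖x - z‖) ≤ N := by
      rw [h2] at h1; rw [hN]; linarith
    have h5 := le_abs_self N
    have h6 := abs_nonneg N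
    have h7 : 0 ≤ c * ‖a‖ := by positivity
    have h8 : 1 ≤ ‖x - z‖ := by linarith
    have h9 : |N| + 1 / 2 ≤ 1 / 2 * ‖x - z‖ - c * ‖a‖ := by linarith
    nlinarith
  obtain ⟨p, -, hp⟩ := LowerSemicontinuousOn.exists_isMinOn (s := Metric.closedBall z r)
    ⟨u, hball u hu le_rfl⟩ (isCompact_closedBall z r)
    ((lowerSemicontinuous_add_mul hR hcl (q := fun x => 1 / 2 * ‖x - z‖ ^ 2)
      (by fun_prop) hc).lowerSemicontinuousOn _)
  refine ⟨p, fun y => ?_⟩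
  by_cases hy : y ∈ Metric.closedBall z r
  · exact hp hy
  refine (hp (hball u hu le_rfl)).trans ?_
  simp only
  by_cases hyd : y ∈ dom R
  · have := lt_of_not_ge fun h => hy (hball y hyd h)
    rw [← hR.coe_toReal hyd, ← hR.coe_toReal hu]
    exact_mod_cast this.le
  · have h1 : R y = ⊤ := not_lt_top_iff.1 hyd
    rw [h1, EReal.coe_mul_top_of_pos hc, EReal.coe_add_top]
    exact le_top

theorem hasGradientAt_half_norm_sub_sq (z p : Vec d) :
    HasGradientAt (fun x => 1 / 2 * ‖x - z‖ ^ 2) (p - z) p := by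
  rw [hasGradientAt_iff_hasFDerivAt]
  have h := (((hasStrictFDerivAt_norm_sq (p - z)).hasFDerivAt).comp p
    ((hasFDerivAt_id p).sub_const z)).const_mul (1 / 2 : ℝ)
  refine h.congr_fderiv ?_
  ext v
  simp

/-- The variational inequality that characterizes a proximal point. -/
theorem inner_le_of_isMinimizer_prox (hR : IsProper R) (hconv : IsConvexFun R) {c : ℝ}
    (hc : 0 < c) {z p u : Vec d}
    (hp : IsMinimizer (fun x => ((1 / 2 * ‖x - z‖ ^ 2 : ℝ) : EReal) + (c : EReal) * R x) p)
    (hu : u ∈ dom R) : inner ℝ (z - p) (u - p) ≤ c * ((R u).toReal - (R p).toReal) := by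
  have h := hp.sub_inner_le hc hR hconv (hasGradientAt_half_norm_sub_sq z p) hu
  rw [← neg_sub p z, inner_neg_left]
  linarith

/-- By monotonicity of the subdifferential, `‖p' - p‖² ≤ ⟪z' - z, p' - p⟫`, so the proximal operator is
nonexpansive and Cauchy–Schwarz gives the bound. -/
theorem inner_sub_le_of_isMinimizer_prox (hR : IsProper R) (hconv : IsConvexFun R) {c : ℝ}
    (hc : 0 < c) {z z' p p' : Vec d}
    (hp : IsMinimizer (fun x => ((1 / 2 * ‖x - z‖ ^ 2 : ℝ) : EReal) + (c : EReal) * R x) p)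
    (hp' : IsMinimizer (fun x => ((1 / 2 * ‖x - z'‖ ^ 2 : ℝ) : EReal) + (c : EReal) * R x) p') :
    inner ℝ (z' - z) (p' - p) ≤ ‖z' - z‖ ^ 2 := by
  have h1 := inner_le_of_isMinimizer_prox hR hconv hc hp (hp'.mem_dom hc hR)
  have h2 := inner_le_of_isMinimizer_prox hR hconv hc hp' (hp.mem_dom hc hR)
  have h3 : ‖p' - p‖ ^ 2 = inner ℝ (z - p) (p' - p) + inner ℝ (z' - p') (p - p')
      + inner ℝ (z' - z) (p' - p) := by
    rw [← neg_sub p' p, inner_neg_right, ← real_inner_self_eq_norm_sq, ← sub_eq_add_neg,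
      ← inner_sub_left, ← inner_add_left]
    congr 1
    abel
  have h4 := real_inner_le_norm (z' - z) (p' - p)
  nlinarith [sq_nonneg (‖z' - z‖ - ‖p' - p‖), norm_nonneg (z' - z), norm_nonneg (p' - p)]

end MS2GD

/-! ### One proximal step with a stochastic gradient estimate -/

namespace MS2GD

variable {d n : ℕ} {f : Fin n → Vec d → ℝ} {R : Vec d → EReal} {L : ℝ}

theorem hasGradientAt_avg (hd : ∀ i, Differentiable ℝ (f i)) (x : Vec d) :
    HasGradientAt (avg f) ((1 / (n : ℝ)) • ∑ i, gradient (f i) x) x := by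
  rw [hasGradientAt_iff_hasFDerivAt]
  have h := (HasFDerivAt.fun_sum (u := Finset.univ)
    fun i _ => ((hd i x).hasGradientAt).hasFDerivAt).const_mul (1 / (n : ℝ))
  refine h.congr_fderiv ?_
  simp

theorem inner_gradient_avg (hd : ∀ i, Differentiable ℝ (f i)) (x v : Vec d) :
    inner ℝ (gradient (avg f) x) v = (1 / (n : ℝ)) * ∑ i, inner ℝ (gradient (f i) x) v := by
  rw [(hasGradientAt_avg hd x).gradient, real_inner_smul_left, sum_inner]

theorem add_inner_gradient_avg_le (hc : ∀ i, ConvexOn ℝ Set.univ (f i))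
    (hd : ∀ i, Differentiable ℝ (f i)) (x y : Vec d) :
    avg f x + inner ℝ (gradient (avg f) x) (y - x) ≤ avg f y := by
  rw [inner_gradient_avg hd, avg, avg, ← mul_add, ← Finset.sum_add_distrib]
  gcongr with i
  exact (hc i).add_inner_gradient_le (hd i) x y

theorem avg_le_add_inner_gradient_add_sq (hn : 1 ≤ n) (hd : ∀ i, Differentiable ℝ (f i))
    (hl : ∀ i x y, ‖gradient (f i) x - gradient (f i) y‖ ≤ L * ‖x - y‖) (x y : Vec d) :
    avg f y ≤ avg f x + inner ℝ (gradient (avg f) x) (y - x) + L / 2 * ‖y - x‖ ^ 2 := by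
  have hn' : (n : ℝ) ≠ 0 := by positivity
  have h : L / 2 * ‖y - x‖ ^ 2 = (1 / (n : ℝ)) * ∑ _i : Fin n, L / 2 * ‖y - x‖ ^ 2 := by
    simp; field_simp
  rw [inner_gradient_avg hd, avg, avg, h, ← mul_add, ← mul_add, ← Finset.sum_add_distrib,
    ← Finset.sum_add_distrib]
  gcongr with i
  exact le_add_inner_gradient_add_sq (hd i) (hl i) x y

/-- The Bregman distance of `F` between `y` and the reference point `z`,
`F y - F z - ⟪∇F z, y - z⟫`. -/
noncomputable def bregman (f : Fin n → Vec d → ℝ) (z y : Vec d) : ℝ :=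
  avg f y - avg f z - inner ℝ (gradient (avg f) z) (y - z)

/-- Cocoercivity averaged over the components `f_i`. -/
theorem avg_norm_gradient_sub_sq_le (hL : 0 < L) (hc : ∀ i, ConvexOn ℝ Set.univ (f i))
    (hd : ∀ i, Differentiable ℝ (f i))
    (hl : ∀ i x y, ‖gradient (f i) x - gradient (f i) y‖ ≤ L * ‖x - y‖) (z y : Vec d) :
    (1 / (n : ℝ)) * ∑ i, ‖gradient (f i) y - gradient (f i) z‖ ^ 2 ≤ 2 * L * bregman f z y := by
  have h : 2 * L * bregman f z y = (1 / (n : ℝ)) * ∑ i, 2 * L * (f i y - f i z -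
      inner ℝ (gradient (f i) z) (y - z)) := by
    rw [bregman, inner_gradient_avg hd, avg, avg, ← Finset.mul_sum, Finset.sum_sub_distrib,
      Finset.sum_sub_distrib]
    ring
  rw [h]
  gcongr with i
  exact (hc i).norm_sub_gradient_sq_le hL (hd i) (hl i) y z

theorem avg_norm_gradient_sub_sq_le_add (hL : 0 < L) (hc : ∀ i, ConvexOn ℝ Set.univ (f i))
    (hd : ∀ i, Differentiable ℝ (f i))
    (hl : ∀ i x y, ‖gradient (f i) x - gradient (f i) y‖ ≤ L * ‖x - y‖) (z x y : Vec d) :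
    (1 / (n : ℝ)) * ∑ i, ‖gradient (f i) y - gradient (f i) x‖ ^ 2 ≤
      4 * L * (bregman f z y + bregman f z x) := by
  have h1 := avg_norm_gradient_sub_sq_le hL hc hd hl z y
  have h2 := avg_norm_gradient_sub_sq_le hL hc hd hl z x
  calc _ ≤ (1 / (n : ℝ)) * ∑ i, (2 * ‖gradient (f i) y - gradient (f i) z‖ ^ 2 +
          2 * ‖gradient (f i) x - gradient (f i) z‖ ^ 2) := by
        gcongr ?_ * (∑ i, ?_) with i
        have h := parallelogram_law_with_norm ℝ (gradient (f i) y - gradient (f i) z)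
          (gradient (f i) x - gradient (f i) z)
        rw [sub_sub_sub_cancel_right] at h
        nlinarith [norm_nonneg ((gradient (f i) y - gradient (f i) z) +
          (gradient (f i) x - gradient (f i) z))]
    _ ≤ _ := by
        rw [Finset.sum_add_distrib, ← Finset.mul_sum, ← Finset.mul_sum]
        linarith

theorem gradEstimate_sub_gradient (hd : ∀ i, Differentiable ℝ (f i)) (b : ℕ) (x y : Vec d)
    (A : Finset (Fin n)) :
    gradEstimate f b x y A - gradient (avg f) y =
      (1 / (b : ℝ)) • ∑ i ∈ A, (gradient (f i) y - gradient (f i) x) -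
        (1 / (n : ℝ)) • ∑ i, (gradient (f i) y - gradient (f i) x) := by
  rw [gradEstimate, (hasGradientAt_avg hd x).gradient, (hasGradientAt_avg hd y).gradient,
    Finset.sum_sub_distrib (s := Finset.univ), smul_sub (1 / (n : ℝ))]
  abel

theorem sum_norm_gradEstimate_sub_sq_le {b : ℕ} (hb : 1 ≤ b) (hbn : b ≤ n) (hL : 0 < L)
    (hc : ∀ i, ConvexOn ℝ Set.univ (f i)) (hd : ∀ i, Differentiable ℝ (f i))
    (hl : ∀ i x y, ‖gradient (f i) x - gradient (f i) y‖ ≤ L * ‖x - y‖) (z x y : Vec d) :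
    ∑ A ∈ Finset.powersetCard b Finset.univ, ‖gradEstimate f b x y A - gradient (avg f) y‖ ^ 2 ≤
      n.choose b * (alpha n b * (4 * L * (bregman f z y + bregman f z x))) := by
  simp_rw [gradEstimate_sub_gradient hd]
  refine (sum_powersetCard_norm_avg_sub_sq_le hb hbn _).trans ?_
  have := alpha_nonneg hb hbn
  gcongr ?_ * (?_ * ?_)
  exact avg_norm_gradient_sub_sq_le_add hL hc hd hl z x y

/-- One proximal step along `v`, compared with an arbitrary point `u` of the domain. The proximal
point `p'` of the exact gradient step decouples the error `v - ∇F y` from the random point `p`. -/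
theorem norm_sub_sq_add_le_of_prox (hn : 1 ≤ n) (hL : 0 < L)
    (hc : ∀ i, ConvexOn ℝ Set.univ (f i)) (hd : ∀ i, Differentiable ℝ (f i))
    (hl : ∀ i x y, ‖gradient (f i) x - gradient (f i) y‖ ≤ L * ‖x - y‖)
    (hR : IsProper R) (hconv : IsConvexFun R) {h : ℝ} (hh : 0 < h) (hhL : h ≤ 1 / L)
    {y v p p' u : Vec d} (hu : u ∈ dom R)
    (hp : IsMinimizer (fun x => ((1 / 2 * ‖x - (y - h • v)‖ ^ 2 : ℝ) : EReal) +
      (h : EReal) * R x) p)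
    (hp' : IsMinimizer (fun x => ((1 / 2 * ‖x - (y - h • gradient (avg f) y)‖ ^ 2 : ℝ) : EReal) +
      (h : EReal) * R x) p') :
    ‖p - u‖ ^ 2 + 2 * h * (avg f p + (R p).toReal - (avg f u + (R u).toReal)) ≤
      ‖y - u‖ ^ 2 + 2 * h ^ 2 * ‖v - gradient (avg f) y‖ ^ 2 +
        2 * h * inner ℝ (v - gradient (avg f) y) (u - p') := by
  have h1 := inner_le_of_isMinimizer_prox hR hconv hh hp hu
  have h2 := inner_sub_le_of_isMinimizer_prox hR hconv hh hp hp'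
  have h3 := add_inner_gradient_avg_le hc hd y u
  have h4 := avg_le_add_inner_gradient_add_sq hn hd hl y p
  set g := gradient (avg f) y
  have h5 : y - h • g - (y - h • v) = h • (v - g) := by rw [smul_sub]; abel
  have h6 : y - h • v - p = (y - p) - h • v := by abel
  rw [h5, real_inner_smul_left, norm_smul, mul_pow, Real.norm_of_nonneg hh.le] at h2
  rw [h6, inner_sub_left, real_inner_smul_left] at h1
  have h2' : inner ℝ (v - g) (p' - p) ≤ h * ‖v - g‖ ^ 2 := by
    refine le_of_mul_le_mul_left ?_ hh
    linarith
  have h7 : ‖y - u‖ ^ 2 = ‖y - p‖ ^ 2 - 2 * inner ℝ (y - p) (u - p) + ‖p - u‖ ^ 2 := by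
    rw [norm_sub_rev p u, ← norm_sub_sq_real, sub_sub_sub_cancel_right]
  have h8 : inner ℝ (v - g) (u - p') + inner ℝ (v - g) (p' - p) =
      inner ℝ v (u - p) - inner ℝ g (u - p) := by
    rw [← inner_add_right, sub_add_sub_cancel, inner_sub_left]
  have h9 : inner ℝ g (u - y) - inner ℝ g (p - y) = inner ℝ g (u - p) := by
    rw [← inner_sub_right, sub_sub_sub_cancel_right]
  have h10 : h * L ≤ 1 := by rwa [le_div_iff₀ hL] at hhL
  rw [norm_sub_rev p y] at h4
  have h11 : h * (L / 2 * ‖y - p‖ ^ 2) ≤ 1 / 2 * ‖y - p‖ ^ 2 := by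
    nlinarith [sq_nonneg ‖y - p‖]
  have h12 := mul_le_mul_of_nonneg_left h3 hh.le
  have h13 := mul_le_mul_of_nonneg_left h4 hh.le
  have h14 := mul_le_mul_of_nonneg_left h2' hh.le
  have h15 := congrArg (h * ·) h8
  have h16 := congrArg (h * ·) h9
  simp only [mul_add, mul_sub] at *
  nlinarith

/-- The one-step inequality, summed over all mini-batches: the estimator is unbiased, so the inner
products with the error cancel, and its variance is controlled by Bregman distances. -/
theorem sum_norm_prox_sub_sq_add_le {b : ℕ} (hb : 1 ≤ b) (hbn : b ≤ n) (hL : 0 < L)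
    (hc : ∀ i, ConvexOn ℝ Set.univ (f i)) (hd : ∀ i, Differentiable ℝ (f i))
    (hl : ∀ i x y, ‖gradient (f i) x - gradient (f i) y‖ ≤ L * ‖x - y‖)
    (hR : IsProper R) (hconv : IsConvexFun R) {h : ℝ} (hh : 0 < h) (hhL : h ≤ 1 / L)
    (hprox : ∀ z, IsMinimizer (fun x => ((1 / 2 * ‖x - z‖ ^ 2 : ℝ) : EReal) +
      (h : EReal) * R x) (prox h R z))
    {u : Vec d} (hu : u ∈ dom R) (x y : Vec d) (p : Finset (Fin n) → Vec d)
    (hp : ∀ A, p A = prox h R (y - h • gradEstimate f b x y A)) :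
    ∑ A ∈ Finset.powersetCard b Finset.univ, (‖p A - u‖ ^ 2 +
        2 * h * (avg f (p A) + (R (p A)).toReal - (avg f u + (R u).toReal))) ≤
      n.choose b * (‖y - u‖ ^ 2 +
        8 * h ^ 2 * L * alpha n b * (bregman f u y + bregman f u x)) := by
  have hstep := fun A => norm_sub_sq_add_le_of_prox (hb.trans hbn) hL hc hd hl hR hconv hh hhL hu
    (hprox (y - h • gradEstimate f b x y A)) (hprox (y - h • gradient (avg f) y))
  simp only [← hp] at hstep
  refine (Finset.sum_le_sum fun A _ => hstep A).trans ?_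
  rw [Finset.sum_add_distrib, Finset.sum_add_distrib, ← Finset.mul_sum, ← Finset.mul_sum,
    ← sum_inner]
  have h0 : ∑ A ∈ Finset.powersetCard b Finset.univ,
      (gradEstimate f b x y A - gradient (avg f) y) = 0 := by
    simp_rw [gradEstimate_sub_gradient hd]
    exact sum_powersetCard_avg_sub_avg hb _
  have h1 := sum_norm_gradEstimate_sub_sq_le hb hbn hL hc hd hl u x y
  rw [h0, inner_zero_left, Finset.sum_const, Finset.card_powersetCard, Finset.card_univ,
    Fintype.card_fin, nsmul_eq_mul]
  have h2 := mul_le_mul_of_nonneg_left h1 (by positivity : 0 ≤ 2 * h ^ 2)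
  linarith

end MS2GD

namespace MS2GD

/-! ### The suboptimality gap -/

section Gap

variable {d n : ℕ} {f : Fin n → Vec d → ℝ} {R : Vec d → EReal} {xs : Vec d}

/-- The objective in the form `q + c R` with `c = 1`, to which the optimality condition applies. -/
theorem IsMinimizer.one_mul (hxs : IsMinimizer (objective f R) xs) :
    IsMinimizer (fun x => (avg f x : EReal) + ((1 : ℝ) : EReal) * R x) xs := fun y => by
  simpa [objective] using hxs y

theorem objective_eq_coe (hR : IsProper R) {x : Vec d} (hx : x ∈ dom R) :
    objective f R x = ((avg f x + (R x).toReal : ℝ) : EReal) := by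
  rw [objective, ← hR.coe_toReal hx, EReal.coe_add, EReal.toReal_coe]

theorem objective_eq_top {x : Vec d} (hx : x ∉ dom R) : objective f R x = ⊤ := by
  have h : R x = ⊤ := not_lt_top_iff.1 hx
  rw [objective, h, EReal.coe_add_top]

theorem gap_eq_ofReal (hR : IsProper R) (hxs : xs ∈ dom R) {x : Vec d} (hx : x ∈ dom R) :
    gap (objective f R) xs x =
      ENNReal.ofReal (avg f x + (R x).toReal - (avg f xs + (R xs).toReal)) := by
  rw [gap, objective_eq_coe hR hx, objective_eq_coe hR hxs, ← EReal.coe_sub,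
    EReal.toENNReal_of_ne_top (EReal.coe_ne_top _), EReal.toReal_coe]

theorem gap_eq_top (hR : IsProper R) (hxs : xs ∈ dom R) {x : Vec d} (hx : x ∉ dom R) :
    gap (objective f R) xs x = ⊤ := by
  rw [gap, objective_eq_top hx, objective_eq_coe hR hxs, EReal.top_sub_coe, EReal.toENNReal_top]

/-- The first-order condition at `x_*` bounds the Bregman distance of `F` by the gap of `P`. -/
theorem ofReal_bregman_le_gap (hd : ∀ i, Differentiable ℝ (f i)) (hR : IsProper R)
    (hconv : IsConvexFun R) (hxs : IsMinimizer (objective f R) xs) (y : Vec d) :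
    ENNReal.ofReal (bregman f xs y) ≤ gap (objective f R) xs y := by
  have hxd := hxs.one_mul.mem_dom one_pos hR
  by_cases hy : y ∈ dom R
  · rw [gap_eq_ofReal hR hxd hy]
    refine ENNReal.ofReal_le_ofReal ?_
    have hg := hasGradientAt_avg hd xs
    have h := hxs.one_mul.sub_inner_le one_pos hR hconv hg hy
    rw [← hg.gradient] at h
    rw [bregman]
    linarith
  · rw [gap_eq_top hR hxd hy]
    exact le_top

/-- Quadratic growth at the minimizer: strong convexity for the subgradient `0`. -/
theorem ofReal_norm_sub_sq_le_gap {μ : ℝ} (hR : IsProper R)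
    (hP : IsStronglyConvex μ (objective f R)) (hxs : IsMinimizer (objective f R) xs) (y : Vec d) :
    ENNReal.ofReal (μ / 2 * ‖y - xs‖ ^ 2) ≤ gap (objective f R) xs y := by
  have hxd := hxs.one_mul.mem_dom one_pos hR
  have hdom : ∀ {x}, x ∈ dom R → x ∈ dom (objective f R) := fun hx => by
    rw [dom, Set.mem_ofPred_eq, objective_eq_coe hR hx]
    exact EReal.coe_lt_top _
  by_cases hy : y ∈ dom R
  · rw [gap_eq_ofReal hR hxd hy]
    refine ENNReal.ofReal_le_ofReal ?_
    have h := hP xs (hdom hxd) y (hdom hy) 0 ⟨hdom hxd, fun z => by simpa using hxs z⟩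
    rw [objective_eq_coe hR hxd, objective_eq_coe hR hy, inner_zero_left, zero_add] at h
    have h' : avg f xs + (R xs).toReal + μ / 2 * ‖y - xs‖ ^ 2 ≤ avg f y + (R y).toReal := by
      exact_mod_cast h
    linarith
  · rw [gap_eq_top hR hxd hy]
    exact le_top

end Gap

/-! ### Expectations under discrete laws -/

section Expect

variable {α β : Type*}

theorem expect_pure (a : α) (g : α → ℝ≥0∞) : expect (PMF.pure a) g = g a := by
  rw [expect, tsum_eq_single a fun b hb => by simp [PMF.pure_apply_of_ne _ _ hb]]
  simp

theorem expect_bind (p : PMF α) (q : α → PMF β) (g : β → ℝ≥0∞) :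
    expect (p.bind q) g = expect p fun a => expect (q a) g := by
  simp only [expect, PMF.bind_apply, ← ENNReal.tsum_mul_right, ← ENNReal.tsum_mul_left]
  rw [ENNReal.tsum_comm]
  simp only [mul_assoc]

theorem expect_map (p : PMF α) (φ : α → β) (g : β → ℝ≥0∞) :
    expect (p.map φ) g = expect p fun a => g (φ a) := by
  rw [← PMF.bind_pure_comp, expect_bind]
  simp only [Function.comp_apply, expect_pure]

theorem expect_mono (p : PMF α) {g g' : α → ℝ≥0∞} (h : ∀ a, g a ≤ g' a) :
    expect p g ≤ expect p g' :=
  ENNReal.tsum_le_tsum fun a => by gcongr; exact h a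

theorem expect_add (p : PMF α) (g g' : α → ℝ≥0∞) :
    expect p (fun a => g a + g' a) = expect p g + expect p g' := by
  simp only [expect, mul_add, ENNReal.tsum_add]

theorem expect_const_mul (p : PMF α) (c : ℝ≥0∞) (g : α → ℝ≥0∞) :
    expect p (fun a => c * g a) = c * expect p g := by
  simp only [expect, ← ENNReal.tsum_mul_left, mul_left_comm]

theorem expect_const (p : PMF α) (c : ℝ≥0∞) : expect p (fun _ => c) = c := by
  rw [expect, ENNReal.tsum_mul_right, p.tsum_coe, one_mul]

theorem expect_uniformOfFinset {s : Finset α} (hs : s.Nonempty) (g : α → ℝ≥0∞) :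
    expect (PMF.uniformOfFinset s hs) g = (s.card : ℝ≥0∞)⁻¹ * ∑ a ∈ s, g a := by
  rw [expect, tsum_eq_sum (s := s) fun a ha => by
    rw [PMF.uniformOfFinset_apply_of_notMem hs ha, zero_mul], Finset.mul_sum]
  exact Finset.sum_congr rfl fun a ha => by rw [PMF.uniformOfFinset_apply_of_mem hs ha]

theorem expect_miniBatch_le {n b : ℕ} (hb : b ≤ n) {φ : Finset (Fin n) → ℝ} {K : ℝ}
    (h0 : ∀ A, 0 ≤ φ A)
    (h : ∑ A ∈ Finset.powersetCard b Finset.univ, φ A ≤ n.choose b * K) :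
    expect (miniBatch hb) (fun A => ENNReal.ofReal (φ A)) ≤ ENNReal.ofReal K := by
  have hc : n.choose b ≠ 0 := (Nat.choose_pos hb).ne'
  rw [miniBatch, expect_uniformOfFinset, ← ENNReal.ofReal_sum_of_nonneg fun A _ => h0 A,
    Finset.card_powersetCard, Finset.card_univ, Fintype.card_fin,
    ENNReal.inv_mul_le_iff (by exact_mod_cast hc) (ENNReal.natCast_ne_top _),
    ← ENNReal.ofReal_natCast, ← ENNReal.ofReal_mul (Nat.cast_nonneg _)]
  exact ENNReal.ofReal_le_ofReal h

end Expect

/-! ### Contraction over an epoch -/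

/-- Telescoping of the one-step inequality over an epoch. Here `V t` stands for the expected squared
distance to the minimizer and `G t` for the expected gap; that both stay finite, which allows the
terms `κ * G t` to be absorbed on the left, follows from the inequality itself. -/
theorem sum_range_le_of_step {V G : ℕ → ℝ≥0∞} {c κ ν : ℝ} (hc : 0 < c) (hκ : 0 ≤ κ) (hκc : κ < c)
    (hG0 : G 0 ≠ ⊤) (hV0 : V 0 ≤ ENNReal.ofReal ν * G 0) (hν : 0 ≤ ν)
    (hstep : ∀ t, V (t + 1) + ENNReal.ofReal c * G (t + 1) ≤
      V t + ENNReal.ofReal κ * (G t + G 0)) (m : ℕ) :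
    ∑ t ∈ Finset.range m, G (t + 1) ≤
      ENNReal.ofReal ((ν + κ * (m + 1)) / (c - κ)) * G 0 := by
  have hfin : ∀ t, V t ≠ ⊤ ∧ G t ≠ ⊤ := by
    intro t
    induction t with
    | zero => exact ⟨ne_top_of_le_ne_top (ENNReal.mul_ne_top ENNReal.ofReal_ne_top hG0) hV0, hG0⟩
    | succ t ih =>
      have h : V (t + 1) + ENNReal.ofReal c * G (t + 1) ≠ ⊤ :=
        ne_top_of_le_ne_top (ENNReal.add_ne_top.2 ⟨ih.1, ENNReal.mul_ne_top ENNReal.ofReal_ne_top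
          (ENNReal.add_ne_top.2 ⟨ih.2, hG0⟩)⟩) (hstep t)
      obtain ⟨h1, h2⟩ := ENNReal.add_ne_top.1 h
      refine ⟨h1, fun h3 => h2 ?_⟩
      rw [h3, ENNReal.mul_top (by simpa using hc)]
  have hstep' : ∀ t, (V (t + 1)).toReal + c * (G (t + 1)).toReal ≤
      (V t).toReal + κ * ((G t).toReal + (G 0).toReal) := by
    intro t
    have h1 := ENNReal.add_ne_top.2 ⟨(hfin t).2, hG0⟩
    have h2 := ENNReal.mul_ne_top (ENNReal.ofReal_ne_top (r := κ)) h1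
    have h := ENNReal.toReal_mono (ENNReal.add_ne_top.2 ⟨(hfin t).1, h2⟩) (hstep t)
    rwa [ENNReal.toReal_add (hfin _).1 (ENNReal.mul_ne_top ENNReal.ofReal_ne_top (hfin _).2),
      ENNReal.toReal_add (hfin t).1 h2, ENNReal.toReal_mul, ENNReal.toReal_mul,
      ENNReal.toReal_ofReal hc.le, ENNReal.toReal_ofReal hκ,
      ENNReal.toReal_add (hfin t).2 hG0] at h
  have hV0' : (V 0).toReal ≤ ν * (G 0).toReal := by
    have h := ENNReal.toReal_mono (ENNReal.mul_ne_top ENNReal.ofReal_ne_top hG0) hV0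
    rwa [ENNReal.toReal_mul, ENNReal.toReal_ofReal hν] at h
  have hsum : ∀ m : ℕ, (V m).toReal + κ * (G m).toReal +
      (c - κ) * ∑ t ∈ Finset.range m, (G (t + 1)).toReal ≤
      (V 0).toReal + κ * (m + 1) * (G 0).toReal := by
    intro m
    induction m with
    | zero => simp
    | succ m ih =>
      rw [Finset.sum_range_succ]
      push_cast
      linarith [hstep' m]
  have hs := hsum m
  have hV := ENNReal.toReal_nonneg (a := V m)
  have hG := mul_nonneg hκ (ENNReal.toReal_nonneg (a := G m))
  have hck : 0 < c - κ := sub_pos.2 hκc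
  have hle : ∑ t ∈ Finset.range m, (G (t + 1)).toReal ≤
      (ν + κ * (m + 1)) / (c - κ) * (G 0).toReal := by
    rw [div_mul_eq_mul_div, le_div_iff₀ hck]
    linarith
  rw [← ENNReal.ofReal_toReal hG0, ← ENNReal.ofReal_mul (by positivity),
    Finset.sum_congr rfl fun t _ => (ENNReal.ofReal_toReal (hfin (t + 1)).2).symm,
    ← ENNReal.ofReal_sum_of_nonneg fun t _ => ENNReal.toReal_nonneg]
  exact ENNReal.ofReal_le_ofReal hle

section Method

variable {d n b m : ℕ} {f : Fin n → Vec d → ℝ} {R : Vec d → EReal} {L μ h : ℝ} {xs : Vec d}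

/-- The expected effect of one inner step from `y` with reference point `x`. No membership of `x` or
`y` in the domain is needed, since Bregman distances are finite and bounded by the gap. -/
theorem expect_step_le (hb1 : 1 ≤ b) (hbn : b ≤ n) (hL : 0 < L)
    (hc : ∀ i, ConvexOn ℝ Set.univ (f i)) (hd : ∀ i, Differentiable ℝ (f i))
    (hl : ∀ i x y, ‖gradient (f i) x - gradient (f i) y‖ ≤ L * ‖x - y‖)
    (hR : IsProper R) (hconv : IsConvexFun R) (hclosed : IsClosedFun R)
    (hxs : IsMinimizer (objective f R) xs) (hh : 0 < h) (hhL : h ≤ 1 / L) (x y : Vec d) :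
    expect ((miniBatch hbn).map fun A => prox h R (y - h • gradEstimate f b x y A))
        (fun p => ENNReal.ofReal (‖p - xs‖ ^ 2) +
          ENNReal.ofReal (2 * h) * gap (objective f R) xs p) ≤
      ENNReal.ofReal (‖y - xs‖ ^ 2) + ENNReal.ofReal (8 * h ^ 2 * L * alpha n b) *
        (gap (objective f R) xs y + gap (objective f R) xs x) := by
  have hxd := hxs.one_mul.mem_dom one_pos hR
  have hprox : ∀ z, IsMinimizer (fun x => ((1 / 2 * ‖x - z‖ ^ 2 : ℝ) : EReal) +
      (h : EReal) * R x) (prox h R z) := by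
    -- The first-order condition at `xs` provides the affine minorant of `R`.
    refine isMinimizer_prox hR hclosed hh (a := -gradient (avg f) xs)
      (β := (R xs).toReal + inner ℝ (gradient (avg f) xs) xs) fun u hu => ?_
    have hg := hasGradientAt_avg hd xs
    have h := hxs.one_mul.sub_inner_le one_pos hR hconv hg hu
    rw [← hg.gradient, inner_sub_right] at h
    rw [inner_neg_left]
    linarith
  have hpd : ∀ z, prox h R z ∈ dom R := fun z => (hprox z).mem_dom hh hR
  have hnn : ∀ z ∈ dom R, 0 ≤ avg f z + (R z).toReal - (avg f xs + (R xs).toReal) := fun z hz => by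
    have := hxs.one_mul.toReal_le one_pos hR hz
    linarith
  have hα := alpha_nonneg hb1 hbn
  have hκ : 0 ≤ 8 * h ^ 2 * L * alpha n b := by positivity
  rw [expect_map]
  calc _ = expect (miniBatch hbn) fun A => ENNReal.ofReal
          (‖prox h R (y - h • gradEstimate f b x y A) - xs‖ ^ 2 + 2 * h *
            (avg f (prox h R (y - h • gradEstimate f b x y A)) +
              (R (prox h R (y - h • gradEstimate f b x y A))).toReal -
              (avg f xs + (R xs).toReal))) := by
        congr 1
        funext A
        rw [gap_eq_ofReal hR hxd (hpd _), ← ENNReal.ofReal_mul (by positivity),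
          ← ENNReal.ofReal_add (by positivity) (mul_nonneg (by positivity) (hnn _ (hpd _)))]
    _ ≤ ENNReal.ofReal (‖y - xs‖ ^ 2 +
          8 * h ^ 2 * L * alpha n b * (bregman f xs y + bregman f xs x)) :=
        expect_miniBatch_le hbn
          (fun A => add_nonneg (by positivity) (mul_nonneg (by positivity) (hnn _ (hpd _))))
          (sum_norm_prox_sub_sq_add_le hb1 hbn hL hc hd hl hR hconv hh hhL hprox hxd x y _
            fun _ => rfl)
    _ ≤ _ := by
        refine ENNReal.ofReal_add_le.trans ?_
        rw [ENNReal.ofReal_mul hκ]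
        gcongr
        exact ENNReal.ofReal_add_le.trans (add_le_add (ofReal_bregman_le_gap hd hR hconv hxs y)
          (ofReal_bregman_le_gap hd hR hconv hxs x))

theorem rate_pos (hb1 : 1 ≤ b) (hbn : b ≤ n) (hm : 1 ≤ m) (hL : 0 < L) (hμ : 0 < μ) (hh : 0 < h)
    (hα : 4 * h * L * alpha n b < 1) : 0 < rate n b m h L μ := by
  have h1 := alpha_nonneg hb1 hbn
  have h2 : 0 < 1 - 4 * h * L * alpha n b := sub_pos.2 hα
  have h3 : (0 : ℝ) < m := by exact_mod_cast hm
  unfold rate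
  positivity

/-- One epoch contracts the expected gap by the factor `ρ`. -/
theorem expect_epoch_gap_le (hb1 : 1 ≤ b) (hbn : b ≤ n) (hm : 1 ≤ m) (hL : 0 < L) (hμ : 0 < μ)
    (hc : ∀ i, ConvexOn ℝ Set.univ (f i)) (hd : ∀ i, Differentiable ℝ (f i))
    (hl : ∀ i x y, ‖gradient (f i) x - gradient (f i) y‖ ≤ L * ‖x - y‖)
    (hR : IsProper R) (hconv : IsConvexFun R) (hclosed : IsClosedFun R)
    (hP : IsStronglyConvex μ (objective f R)) (hxs : IsMinimizer (objective f R) xs)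
    (hh : 0 < h) (hhL : h ≤ 1 / L) (hα : 4 * h * L * alpha n b < 1) (x : Vec d) :
    expect (epoch hbn hm f R h x) (gap (objective f R) xs) ≤
      ENNReal.ofReal (rate n b m h L μ) * gap (objective f R) xs x := by
  have hα0 := alpha_nonneg hb1 hbn
  -- Outside the domain the gap is infinite, and the bound holds because `ρ > 0`.
  by_cases htop : gap (objective f R) xs x = ⊤
  · rw [htop, ENNReal.mul_top (by simpa using rate_pos hb1 hbn hm hL hμ hh hα)]
    exact le_top
  let V : ℕ → ℝ≥0∞ := fun t =>
    expect (innerIterate hbn f R h x t) fun y => ENNReal.ofReal (‖y - xs‖ ^ 2)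
  let G : ℕ → ℝ≥0∞ := fun t => expect (innerIterate hbn f R h x t) (gap (objective f R) xs)
  have hG0 : G 0 = gap (objective f R) xs x := expect_pure _ _
  have hV0 : V 0 ≤ ENNReal.ofReal (2 / μ) * G 0 := by
    calc V 0 = ENNReal.ofReal (2 / μ) * ENNReal.ofReal (μ / 2 * ‖x - xs‖ ^ 2) := by
          rw [← ENNReal.ofReal_mul (by positivity)]
          refine (expect_pure _ _).trans (congrArg _ ?_)
          field_simp
      _ ≤ _ := by
          rw [hG0]
          gcongr
          exact ofReal_norm_sub_sq_le_gap hR hP hxs x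
  have hstep : ∀ t, V (t + 1) + ENNReal.ofReal (2 * h) * G (t + 1) ≤
      V t + ENNReal.ofReal (8 * h ^ 2 * L * alpha n b) * (G t + G 0) := by
    intro t
    have h1 := expect_mono (innerIterate hbn f R h x t) fun y =>
      expect_step_le hb1 hbn hL hc hd hl hR hconv hclosed hxs hh hhL x y
    rw [← expect_bind, expect_add, expect_add, expect_const_mul, expect_const_mul, expect_add,
      expect_const, ← hG0] at h1
    exact h1
  have hsum := sum_range_le_of_step (by positivity : 0 < 2 * h)
    (by positivity : 0 ≤ 8 * h ^ 2 * L * alpha n b) (by nlinarith) (hG0 ▸ htop) hV0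
    (by positivity) hstep m
  have hm0 : (0 : ℝ) < m := by exact_mod_cast hm
  have h1α : (1 - 4 * h * L * alpha n b) ≠ 0 := (sub_pos.2 hα).ne'
  have hrate : (m : ℝ) * rate n b m h L μ =
      (2 / μ + 8 * h ^ 2 * L * alpha n b * (m + 1)) / (2 * h - 8 * h ^ 2 * L * alpha n b) := by
    have e : 2 * h - 8 * h ^ 2 * L * alpha n b = 2 * h * (1 - 4 * h * L * alpha n b) := by ring
    rw [e, rate]
    field_simp
    ring
  rw [epoch, expect_bind, epochLength, expect_uniformOfFinset, Nat.card_Icc, Nat.add_sub_cancel,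
    ENNReal.inv_mul_le_iff (by exact_mod_cast hm0.ne') (ENNReal.natCast_ne_top _), ← mul_assoc,
    ← ENNReal.ofReal_natCast, ← ENNReal.ofReal_mul hm0.le, hrate, ← hG0]
  refine le_trans (le_of_eq ?_) hsum
  rw [Finset.range_eq_Ico, Finset.sum_Ico_add' G 0 m 1]
  rfl

end Method

end MS2GD

theorem theorem1 {d n b m : ℕ} (hb1 : 1 ≤ b) (hbn : b ≤ n) (hm : 1 ≤ m)
    (f : Fin n → MS2GD.Vec d → ℝ) (R : MS2GD.Vec d → EReal)
    (L μ h : ℝ) (hL : 0 < L) (hμ : 0 < μ)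
    (hf_convex : ∀ i, ConvexOn ℝ Set.univ (f i))
    (hf_diff : ∀ i, Differentiable ℝ (f i))
    (hf_lip : ∀ i x y, ‖gradient (f i) x - gradient (f i) y‖ ≤ L * ‖x - y‖)
    (hR_proper : MS2GD.IsProper R)
    (hR_convex : MS2GD.IsConvexFun R)
    (hR_closed : MS2GD.IsClosedFun R)
    (hP : MS2GD.IsStronglyConvex μ (MS2GD.objective f R))
    (xs : MS2GD.Vec d) (hxs : MS2GD.IsMinimizer (MS2GD.objective f R) xs)
    (hh0 : 0 < h) (hhL : h ≤ 1 / L)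
    (hα : 4 * h * L * MS2GD.alpha n b < 1)
    (hρ : MS2GD.rate n b m h L μ < 1)
    (x₀ : MS2GD.Vec d) (k : ℕ) :
    MS2GD.expect (MS2GD.iterate hbn hm f R h x₀ k) (MS2GD.gap (MS2GD.objective f R) xs) ≤
      ENNReal.ofReal (MS2GD.rate n b m h L μ ^ k) *
        MS2GD.gap (MS2GD.objective f R) xs x₀ := by
  induction k with
  | zero =>
    rw [pow_zero, ENNReal.ofReal_one, one_mul]
    exact (MS2GD.expect_pure _ _).le
  | succ k ih =>
    rw [MS2GD.iterate, MS2GD.expect_bind]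
    refine (MS2GD.expect_mono _ fun x => MS2GD.expect_epoch_gap_le hb1 hbn hm hL hμ hf_convex
      hf_diff hf_lip hR_proper hR_convex hR_closed hP hxs hh0 hhL hα x).trans ?_
    rw [MS2GD.expect_const_mul, pow_succ', ENNReal.ofReal_mul
      (MS2GD.rate_pos hb1 hbn hm hL hμ hh0 hα).le, mul_assoc]
    gcongr
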